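/- Let $d\ge 0$ be an integer, let $n=(n_1,\dots,n_d)$ be a $d$-tuple of non-negative integers, and let $p\in\mathbb{C}[z_1,\dots,z_d]$ be a polynomial whose degree in $z_j$ is at most $n_j$ for every $j$ and which has no zeros on the closed polydisk $\overline{\mathbb{D}}^d=\{z\in\mathbb{C}^d: |z_j|\le 1 \text{ for all } j\}$. Let $\sigma$ be normalized Lebesgue measure on the torus $\mathbb{T}^d$, and let $\mu$ be the Bernstein–Szegő measure $d\mu=|p|^{-2}\,d\sigma$. For $X\subset\mathbb{Z}^d$ put $$L^2_\mu(X)=\{f\in L^2(\mu): \hat f(\alpha)=0 \text{ for all } \alpha\in\mathbb{Z}^d\setminus X\},\qquad \hat f(\alpha)=\int_{\mathbb{T}^d} f(z)\,\bar z^{\alpha}\,d\sigma(z),$$ and for $Y\subset X$ let $L^2_\mu(X\ominus Y)=L^2_\mu(X)\ominus L^2_\mu(Y)$ be the orthogonal complement of $L^2_\mu(Y)$ in $L^2_\mu(X)$ with respect to the inner product of $L^2(\mu)$. Let $$B=\{\alpha\in\mathbb{Z}^d: \alpha_i\ge 0 \text{ for all } i, \text{ and } \alpha_j<n_j \text{ for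 some } j\},$$ $$X_S=\{\alpha\in\mathbb{Z}^d: \alpha_i\ge 0 \text{ for all } i, \text{ and } \alpha_j<n_j \text{ for some } j\in S\}\qquad (S\subset\{1,\dots,d\}).$$ Then for every partition $S\sqcup T=\{1,\dots,d\}$ (where $S$ or $T$ may be empty), $$L^2_\mu(B)=L^2_\mu(X_S)\oplus L^2_\mu\bigl(X_T\ominus(X_T\cap X_S)\bigr),$$ an orthogonal direct sum in $L^2(\mu)$: the two subspaces on the right are orthogonal to each other in $L^2(\mu)$, and their sum is $L^2_\mu(B)$. -/

import Mathlib

open MeasureTheory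

noncomputable section

namespace BernsteinSzego

variable {d : ℕ}

/-- The `d`-torus `𝕋^d`, parametrised as `(ℝ/ℤ)^d`: the parameter `t` corresponds to the point
`z = (e^{2πi t_1}, …, e^{2πi t_d})` of `ℂ^d`. -/
def point (t : UnitAddTorus (Fin d)) : Fin d → ℂ := fun j => (AddCircle.toCircle (t j) : ℂ)

/-- Normalized Lebesgue measure `σ` on the `d`-torus. -/
def sigma (d : ℕ) : Measure (UnitAddTorus (Fin d)) :=
  Measure.pi fun _ => AddCircle.haarAddCircle

/-- The Bernstein–Szegő measure `dμ = |p|⁻² dσ` on the `d`-torus. -/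
def mu (p : MvPolynomial (Fin d) ℂ) : Measure (UnitAddTorus (Fin d)) :=
  (sigma d).withDensity fun t => ENNReal.ofReal (1 / ‖MvPolynomial.eval (point t) p‖ ^ 2)

/-- `p` has no zeros on the closed unit polydisk. -/
def NoZeros (p : MvPolynomial (Fin d) ℂ) : Prop :=
  ∀ z : Fin d → ℂ, (∀ j, ‖z j‖ ≤ 1) → MvPolynomial.eval z p ≠ 0

/-- The multidegree of `p` is at most `n`: the degree in `z_j` is at most `n_j` for each `j`. -/
def DegLE (p : MvPolynomial (Fin d) ℂ) (n : Fin d → ℕ) : Prop :=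
  ∀ j, p.degreeOf j ≤ n j

/-- The complex Hilbert space `L²(μ)`. -/
abbrev L2 (p : MvPolynomial (Fin d) ℂ) : Type := Lp ℂ 2 (mu p)

/-- The Fourier coefficient `∫ f(z) z^{-α} dσ(z)`, taken with respect to `σ` (not `μ`). -/
def coeff {p : MvPolynomial (Fin d) ℂ} (f : L2 p) (α : Fin d → ℤ) : ℂ :=
  ∫ t, UnitAddTorus.mFourier (-α) t * f t ∂(sigma d)

/-! ### Facts showing that the Fourier coefficients are well defined and linear on `L²(μ)` -/

theorem continuous_point : Continuous (point (d := d)) := by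
  unfold point
  exact continuous_pi fun j => continuous_subtype_val.comp
    ((AddCircle.continuous_toCircle).comp (continuous_apply j))

theorem norm_point (t : UnitAddTorus (Fin d)) (j : Fin d) : ‖point t j‖ = 1 :=
  Circle.norm_coe _

instance : IsProbabilityMeasure (sigma d) := by
  unfold sigma; infer_instance

theorem continuous_eval (p : MvPolynomial (Fin d) ℂ) :
    Continuous fun t : UnitAddTorus (Fin d) => MvPolynomial.eval (point t) p :=
  (MvPolynomial.continuous_eval p).comp continuous_point

theorem sigma_le {p : MvPolynomial (Fin d) ℂ} (hp : NoZeros p) :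
    ∃ c : ENNReal, c ≠ ⊤ ∧ sigma d ≤ c • mu p := by
  obtain ⟨C, hC⟩ := (isCompact_univ (X := UnitAddTorus (Fin d))).exists_bound_of_continuousOn
    (continuous_eval p).continuousOn
  refine ⟨ENNReal.ofReal (C ^ 2), ENNReal.ofReal_ne_top, ?_⟩
  unfold mu
  rw [← withDensity_smul' _ _ ENNReal.ofReal_ne_top]
  conv_lhs => rw [← withDensity_one (μ := sigma d)]
  refine withDensity_mono (Filter.Eventually.of_forall fun t => ?_)
  have h0 : 0 < ‖MvPolynomial.eval (point t) p‖ :=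
    norm_pos_iff.2 (hp _ fun j => (norm_point t j).le)
  have h1 := hC t (Set.mem_univ t)
  simp only [Pi.one_apply, Pi.smul_apply, smul_eq_mul]
  rw [← ENNReal.ofReal_mul (sq_nonneg C), ENNReal.one_le_ofReal, mul_one_div,
    one_le_div (by positivity)]
  gcongr

theorem sigma_ac {p : MvPolynomial (Fin d) ℂ} (hp : NoZeros p) : sigma d ≪ mu p := by
  obtain ⟨c, _, hle⟩ := sigma_le hp
  exact Measure.absolutelyContinuous_of_le_smul hle

theorem integrable_coeff {p : MvPolynomial (Fin d) ℂ} (hp : NoZeros p) (f : L2 p)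
    (α : Fin d → ℤ) :
    Integrable (fun t => UnitAddTorus.mFourier (-α) t * f t) (sigma d) := by
  obtain ⟨c, hc, hle⟩ := sigma_le hp
  have hf : Integrable (fun t => f t) (sigma d) :=
    ((Lp.memLp f).of_measure_le_smul hc hle).integrable (by norm_num)
  refine hf.bdd_mul (c := 1)
    (UnitAddTorus.mFourier (-α)).continuous.aestronglyMeasurable
    (Filter.Eventually.of_forall fun t => ?_)
  exact ((UnitAddTorus.mFourier (-α)).norm_coe_le_norm t).trans_eq UnitAddTorus.mFourier_norm

theorem coeff_zero {p : MvPolynomial (Fin d) ℂ} (hp : NoZeros p) (α : Fin d → ℤ) :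
    coeff (0 : L2 p) α = 0 := by
  unfold coeff
  rw [integral_eq_zero_of_ae]
  filter_upwards [(sigma_ac hp).ae_eq (Lp.coeFn_zero ℂ 2 (mu p))] with t ht
  rw [ht]; simp

theorem coeff_add {p : MvPolynomial (Fin d) ℂ} (hp : NoZeros p) (f g : L2 p) (α : Fin d → ℤ) :
    coeff (f + g) α = coeff f α + coeff g α := by
  unfold coeff
  rw [← integral_add (integrable_coeff hp f α) (integrable_coeff hp g α)]
  refine integral_congr_ae ?_
  filter_upwards [(sigma_ac hp).ae_eq (Lp.coeFn_add f g)] with t ht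
  rw [ht, Pi.add_apply, mul_add]

theorem coeff_smul {p : MvPolynomial (Fin d) ℂ} (hp : NoZeros p) (c : ℂ) (f : L2 p)
    (α : Fin d → ℤ) : coeff (c • f) α = c * coeff f α := by
  unfold coeff
  rw [← integral_const_mul]
  refine integral_congr_ae ?_
  filter_upwards [(sigma_ac hp).ae_eq (Lp.coeFn_smul c f)] with t ht
  rw [ht, Pi.smul_apply, smul_eq_mul]; ring

/-! ### The subspaces -/

/-- `L²_μ(X) = {f ∈ L²(μ) : f̂(α) = 0 for α ∉ X}`. -/
def L2sub (p : MvPolynomial (Fin d) ℂ) (hp : NoZeros p) (X : Set (Fin d → ℤ)) :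
    Submodule ℂ (L2 p) where
  carrier := {f | ∀ α, α ∉ X → coeff f α = 0}
  zero_mem' := fun α _ => coeff_zero hp α
  add_mem' := fun {f g} hf hg α hα => by rw [coeff_add hp, hf α hα, hg α hα, add_zero]
  smul_mem' := fun c f hf α hα => by rw [coeff_smul hp, hf α hα, mul_zero]

/-- `L²_μ(X ⊖ Y) = L²_μ(X) ⊖ L²_μ(Y)`, the orthogonal complement of `L²_μ(Y)` in `L²_μ(X)` for the
inner product of `L²(μ)` (used for `Y ⊆ X`). -/
def L2minus (p : MvPolynomial (Fin d) ℂ) (hp : NoZeros p) (X Y : Set (Fin d → ℤ)) :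
    Submodule ℂ (L2 p) :=
  L2sub p hp X ⊓ (L2sub p hp Y)ᗮ

/-- `B = {α ∈ ℤ₊^d : α ≱ n}`. -/
def setB (n : Fin d → ℕ) : Set (Fin d → ℤ) :=
  {α | 0 ≤ α ∧ ¬ (fun j => (n j : ℤ)) ≤ α}

/-- `X_j = {α ∈ ℤ₊^d : α_j < n_j}`. -/
def setXj (n : Fin d → ℕ) (j : Fin d) : Set (Fin d → ℤ) :=
  {α | 0 ≤ α ∧ α j < n j}

/-- `X_S = ⋃_{j ∈ S} X_j`. -/
def setX (n : Fin d → ℕ) (S : Set (Fin d)) : Set (Fin d → ℤ) :=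
  ⋃ j ∈ S, setXj n j

end BernsteinSzego

end

open scoped ENNReal

noncomputable section

namespace BernsteinSzego

variable {d : ℕ}

/-! The map f ↦ F = f/p carries L²(μ) isometrically onto L²(σ). For m = n or m = 0 let H_S^m be the
functions with spectrum in {α : α_j ≥ m_j for j ∈ S}, and H² the case m = 0, S everything. Both p
and 1/p multiply each H_S^m into itself; for 1/p this needs p zero-free on the whole polydisk
(`isUnit_aeval`, `invPolyC_mem`). With the unimodular φ = conj p / p, the space L²_μ(X_S) therefore
becomes H² ∩ (φ H_S^n)^⊥ (`mulL_polyC_mem_setX_iff`), and the degree bound gives φ H_S^n ⊆ H_S^0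
(`mulL_phase_mem`).

The heart is `mulL_polyC_mem_of_orthogonal`: in L²_μ(B), whatever is orthogonal to L²_μ(X_S) lies in
L²_μ(X_T). For h ∈ H_T^n, truncating h to H_S^n and φh to H_S^0 gives h₁ and g₁, and g₁ - φh₁ is a
test vector from the space of X_S; pairing F with it forces F ⟂ φh. The theorem then follows by
projecting onto the closed subspace L²_μ(X_S). -/

/-! ### Multiplication operators and the Fourier basis -/

/-- The Hilbert space `L²(σ)`. -/
abbrev L2sigma (d : ℕ) : Type := Lp ℂ 2 (sigma d)

/-- Multiplication of `L²(σ)` functions by a continuous function, as a bounded operator. -/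
def mulL : C(UnitAddTorus (Fin d), ℂ) →L[ℂ] (L2sigma d →L[ℂ] L2sigma d) :=
  ((ContinuousLinearMap.mul ℂ ℂ).holderL (sigma d) ∞ 2 2).comp
    (ContinuousMap.toLp ∞ (sigma d) ℂ)

theorem coeFn_mulL (c : C(UnitAddTorus (Fin d), ℂ)) (f : L2sigma d) :
    mulL c f =ᵐ[sigma d] fun t => c t * f t := by
  have h := (ContinuousLinearMap.mul ℂ ℂ).coeFn_holder (r := 2)
    (ContinuousMap.toLp (E := ℂ) ∞ (sigma d) ℂ c) f
  refine h.trans ?_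
  filter_upwards [ContinuousMap.coeFn_toLp (p := ∞) (𝕜 := ℂ) (sigma d) c] with t ht
  rw [ht, ContinuousLinearMap.mul_apply']

theorem mulL_mul (a b : C(UnitAddTorus (Fin d), ℂ)) (f : L2sigma d) :
    mulL (a * b) f = mulL a (mulL b f) := by
  refine Lp.ext ?_
  filter_upwards [coeFn_mulL (a * b) f, coeFn_mulL a (mulL b f), coeFn_mulL b f] with t h1 h2 h3
  rw [h1, h2, h3, ContinuousMap.mul_apply, mul_assoc]

theorem mulL_one (f : L2sigma d) : mulL 1 f = f := by
  refine Lp.ext ?_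
  filter_upwards [coeFn_mulL 1 f] with t h1
  rw [h1, ContinuousMap.one_apply, one_mul]

theorem inner_mulL_left (c : C(UnitAddTorus (Fin d), ℂ)) (f g : L2sigma d) :
    inner ℂ (mulL c f) g = inner ℂ f (mulL (star c) g) := by
  rw [L2.inner_def, L2.inner_def]
  refine integral_congr_ae ?_
  filter_upwards [coeFn_mulL c f, coeFn_mulL (star c) g] with t h1 h2
  rw [h1, h2]
  simp only [RCLike.inner_apply, map_mul, ContinuousMap.star_apply, RCLike.star_def]
  ring

/-- The Fourier basis of `L²(σ)`. -/
def fourierBasis (d : ℕ) : HilbertBasis (Fin d → ℤ) ℂ (L2sigma d) :=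
  UnitAddTorus.mFourierBasis

theorem coeFn_fourierBasis (α : Fin d → ℤ) :
    fourierBasis d α =ᵐ[sigma d] UnitAddTorus.mFourier α := by
  have h : fourierBasis d α = UnitAddTorus.mFourierLp 2 α :=
    congrFun UnitAddTorus.coe_mFourierBasis α
  rw [h]
  exact UnitAddTorus.coeFn_mFourierLp 2 α

theorem mulL_mFourier_fourierBasis (α β : Fin d → ℤ) :
    mulL (UnitAddTorus.mFourier α) (fourierBasis d β) = fourierBasis d (α + β) := by
  refine Lp.ext ?_
  filter_upwards [coeFn_mulL (UnitAddTorus.mFourier α) (fourierBasis d β), coeFn_fourierBasis β,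
    coeFn_fourierBasis (α + β)] with t h1 h2 h3
  rw [h1, h2, h3, UnitAddTorus.mFourier_add]

theorem star_mFourier (α : Fin d → ℤ) :
    star (UnitAddTorus.mFourier α) = UnitAddTorus.mFourier (-α) := by
  ext t
  rw [UnitAddTorus.mFourier_neg]; rfl

theorem inner_fourierBasis_mulL_mFourier (α β : Fin d → ℤ) (f : L2sigma d) :
    inner ℂ (fourierBasis d α) (mulL (UnitAddTorus.mFourier β) f) =
      inner ℂ (fourierBasis d (α - β)) f := by
  rw [← neg_neg β, ← star_mFourier (-β), ← inner_mulL_left, mulL_mFourier_fourierBasis]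
  congr 2
  abel

/-! ### Subspaces of prescribed Fourier support -/

/-- The functions in `L²(σ)` whose Fourier coefficients are supported on `X`. -/
def spectralSub (X : Set (Fin d → ℤ)) : Submodule ℂ (L2sigma d) where
  carrier := {f | ∀ α, α ∉ X → inner ℂ (fourierBasis d α) f = 0}
  zero_mem' := fun _ _ => inner_zero_right _
  add_mem' := fun {f g} hf hg α hα => by rw [inner_add_right, hf α hα, hg α hα, add_zero]
  smul_mem' := fun c f hf α hα => by rw [inner_smul_right, hf α hα, mul_zero]

theorem mem_spectralSub {X : Set (Fin d → ℤ)} {f : L2sigma d} :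
    f ∈ spectralSub X ↔ ∀ α, α ∉ X → inner ℂ (fourierBasis d α) f = 0 :=
  Iff.rfl

theorem mem_spectralSub_inter {X Y : Set (Fin d → ℤ)} {f : L2sigma d} :
    f ∈ spectralSub (X ∩ Y) ↔ f ∈ spectralSub X ∧ f ∈ spectralSub Y := by
  simp only [mem_spectralSub, Set.mem_inter_iff, not_and_or]
  exact ⟨fun h => ⟨fun α hα => h α (.inl hα), fun α hα => h α (.inr hα)⟩,
    fun h α hα => hα.elim (h.1 α) (h.2 α)⟩

theorem spectralSub_mono {X Y : Set (Fin d → ℤ)} (h : X ⊆ Y) :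
    spectralSub X ≤ spectralSub Y :=
  fun _ hf α hα => hf α fun hX => hα (h hX)

theorem isClosed_spectralSub (X : Set (Fin d → ℤ)) :
    IsClosed (spectralSub X : Set (L2sigma d)) := by
  have : (spectralSub X : Set (L2sigma d)) =
      ⋂ α, ⋂ (_ : α ∉ X), {f | inner ℂ (fourierBasis d α) f = 0} := by
    ext f; simp [mem_spectralSub]
  rw [this]
  exact isClosed_iInter fun α => isClosed_iInter fun _ =>
    isClosed_eq (continuous_const.inner continuous_id) continuous_const

theorem fourierBasis_mem_spectralSub {X : Set (Fin d → ℤ)} {α : Fin d → ℤ} (h : α ∈ X) :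
    fourierBasis d α ∈ spectralSub X := fun _ hβ =>
  (fourierBasis d).orthonormal.2 fun e => hβ (e ▸ h)

/-- Functions with disjoint Fourier supports are orthogonal. -/
theorem inner_eq_zero_of_disjoint {X Y : Set (Fin d → ℤ)} (h : Disjoint X Y) {f g : L2sigma d}
    (hf : f ∈ spectralSub X) (hg : g ∈ spectralSub Y) : inner ℂ f g = 0 := by
  rw [← (fourierBasis d).tsum_inner_mul_inner f g]
  refine (tsum_congr fun α => ?_).trans tsum_zero
  by_cases hα : α ∈ X
  · rw [hg α (h.notMem_of_mem_left hα), mul_zero]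
  · rw [← inner_conj_symm, hf α hα, map_zero, zero_mul]

theorem mem_spectralSub_compl {X : Set (Fin d → ℤ)} {f : L2sigma d} :
    f ∈ spectralSub Xᶜ ↔ ∀ g ∈ spectralSub X, inner ℂ g f = 0 :=
  ⟨fun hf _ hg => inner_eq_zero_of_disjoint disjoint_compl_right hg hf,
    fun h _ hα => h _ (fourierBasis_mem_spectralSub (Set.notMem_compl_iff.1 hα))⟩

/-- Truncation of the Fourier series to `X`; it does not enlarge the Fourier support. -/
theorem exists_truncation (X : Set (Fin d → ℤ)) (f : L2sigma d) :
    ∃ g ∈ spectralSub X, f - g ∈ spectralSub Xᶜ ∧ ∀ Y, f ∈ spectralSub Y → g ∈ spectralSub Y := by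
  have : CompleteSpace (spectralSub X) := (isClosed_spectralSub X).completeSpace_coe
  have h1 : f - (spectralSub X).starProjection f ∈ spectralSub Xᶜ :=
    mem_spectralSub_compl.2 fun g hg =>
      (Submodule.mem_orthogonal _ _).1 (Submodule.sub_starProjection_mem_orthogonal f) g hg
  refine ⟨(spectralSub X).starProjection f, Submodule.starProjection_apply_mem _ f, h1,
    fun Y hY α hα => ?_⟩
  by_cases hX : α ∈ X
  · have := h1 α (Set.notMem_compl_iff.2 hX)
    rwa [inner_sub_right, hY α hα, zero_sub, neg_eq_zero] at this
  · exact (Submodule.starProjection_apply_mem (spectralSub X) f) α hX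

theorem mulL_mFourier_mem {X Y : Set (Fin d → ℤ)} {β : Fin d → ℤ} (h : ∀ α ∈ X, β + α ∈ Y)
    {f : L2sigma d} (hf : f ∈ spectralSub X) :
    mulL (UnitAddTorus.mFourier β) f ∈ spectralSub Y := fun _ hα => by
  rw [inner_fourierBasis_mulL_mFourier]
  refine hf _ fun hX => hα ?_
  simpa using h _ hX

/-! ### Multiplier algebras and reciprocals of zero-free polynomials -/

/-- The closed algebra of multipliers of a subspace. -/
def multiplierAlg (L : Submodule ℂ (L2sigma d)) :
    Subalgebra ℂ C(UnitAddTorus (Fin d), ℂ) where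
  carrier := {c | ∀ f ∈ L, mulL c f ∈ L}
  mul_mem' := fun {a b} ha hb f hf => by rw [mulL_mul]; exact ha _ (hb f hf)
  add_mem' := fun {a b} ha hb f hf => by
    rw [map_add]; exact L.add_mem (ha f hf) (hb f hf)
  algebraMap_mem' := fun c f hf => by
    rw [Algebra.algebraMap_eq_smul_one, map_smul]
    show c • mulL 1 f ∈ L
    rw [mulL_one]
    exact L.smul_mem c hf

theorem isClosed_multiplierAlg {L : Submodule ℂ (L2sigma d)} (hL : IsClosed (L : Set (L2sigma d))) :
    IsClosed (multiplierAlg L : Set C(UnitAddTorus (Fin d), ℂ)) := by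
  have : (multiplierAlg L : Set C(UnitAddTorus (Fin d), ℂ)) =
      ⋂ f ∈ L, {c | mulL c f ∈ (L : Set (L2sigma d))} := by
    ext c; simp [multiplierAlg]
  rw [this]
  refine isClosed_biInter fun f _ => hL.preimage ?_
  exact (ContinuousLinearMap.apply ℂ (L2sigma d) f).continuous.comp mulL.continuous

/-- The restriction of a polynomial to the torus. -/
def polyC (p : MvPolynomial (Fin d) ℂ) : C(UnitAddTorus (Fin d), ℂ) :=
  ⟨fun t => MvPolynomial.eval (point t) p, continuous_eval p⟩

/-- The reciprocal of a zero-free polynomial on the torus. -/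
def invPolyC (p : MvPolynomial (Fin d) ℂ) (hp : NoZeros p) : C(UnitAddTorus (Fin d), ℂ) :=
  ⟨fun t => (MvPolynomial.eval (point t) p)⁻¹,
    (continuous_eval p).inv₀ fun t => hp _ fun j => (norm_point t j).le⟩

theorem invPolyC_mul (p : MvPolynomial (Fin d) ℂ) (hp : NoZeros p) :
    invPolyC p hp * polyC p = 1 := by
  ext t
  exact inv_mul_cancel₀ (hp _ fun j => (norm_point t j).le)

theorem mFourier_single_apply (j : Fin d) (t : UnitAddTorus (Fin d)) :
    UnitAddTorus.mFourier (Pi.single j 1) t = point t j := by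
  rw [UnitAddTorus.mFourier_single, fourier_one]; rfl

theorem polyC_eq_aeval (p : MvPolynomial (Fin d) ℂ) :
    polyC p = MvPolynomial.aeval
      (fun j => (UnitAddTorus.mFourier (Pi.single j 1) : C(UnitAddTorus (Fin d), ℂ))) p := by
  induction p using MvPolynomial.induction_on with
  | C a => ext t; simp [polyC]
  | add p q hp hq => rw [map_add, ← hp, ← hq]; ext t; simp [polyC]
  | mul_X p j hp =>
    rw [map_mul, ← hp, MvPolynomial.aeval_X]; ext t
    simp [polyC, mFourier_single_apply]

/-- Evaluating a polynomial at the coordinate functions inside a subalgebra gives its restriction to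
the torus. -/
theorem coe_aeval_subtype {A : Subalgebra ℂ C(UnitAddTorus (Fin d), ℂ)}
    (hz : ∀ j, UnitAddTorus.mFourier (Pi.single j 1) ∈ A) (p : MvPolynomial (Fin d) ℂ) :
    (MvPolynomial.aeval (fun j => (⟨_, hz j⟩ : A)) p : A) = polyC p := by
  rw [polyC_eq_aeval]
  exact MvPolynomial.comp_aeval_apply (fun j => (⟨_, hz j⟩ : A)) A.val p

/-- A polynomial without zeros on the closed polydisk is invertible at every tuple of contractions
of a commutative Banach algebra. -/
theorem isUnit_aeval {A : Type*} [NormedCommRing A] [NormedAlgebra ℂ A] [CompleteSpace A]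
    [NormOneClass A] {p : MvPolynomial (Fin d) ℂ} (hp : NoZeros p) (g : Fin d → A)
    (hg : ∀ j, ‖g j‖ ≤ 1) : IsUnit (MvPolynomial.aeval g p) := by
  by_contra hu
  obtain ⟨φ, hφ⟩ := WeakDual.CharacterSpace.exists_apply_eq_zero hu
  let ψ : A →ₐ[ℂ] ℂ := WeakDual.CharacterSpace.equivAlgHom φ
  have h0 : ψ (MvPolynomial.aeval g p) = 0 := hφ
  rw [MvPolynomial.comp_aeval_apply] at h0
  refine hp (fun j => ψ (g j)) (fun j => ?_) ?_
  · exact (spectrum.norm_le_norm_of_mem (AlgHom.apply_mem_spectrum ψ (g j))).trans (hg j)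
  · rwa [← MvPolynomial.coe_aeval_eq_eval]

/-- A closed subalgebra containing the coordinate functions contains the reciprocals of polynomials
without zeros on the closed polydisk: its characters are evaluations at points of the polydisk. -/
theorem invPolyC_mem {A : Subalgebra ℂ C(UnitAddTorus (Fin d), ℂ)}
    (hA : IsClosed (A : Set C(UnitAddTorus (Fin d), ℂ)))
    (hz : ∀ j, UnitAddTorus.mFourier (Pi.single j 1) ∈ A)
    {p : MvPolynomial (Fin d) ℂ} (hp : NoZeros p) : invPolyC p hp ∈ A := by
  have : CompleteSpace A := hA.completeSpace_coe
  have : NormOneClass A := ⟨(norm_one : ‖(1 : C(UnitAddTorus (Fin d), ℂ))‖ = 1)⟩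
  let g : Fin d → A := fun j => ⟨_, hz j⟩
  have hu : IsUnit (MvPolynomial.aeval g p) := isUnit_aeval (A := A) hp g fun j =>
    (UnitAddTorus.mFourier_norm (n := Pi.single j (1 : ℤ))).le
  obtain ⟨b, hb⟩ := hu.exists_left_inv
  have h1 : (b : C(UnitAddTorus (Fin d), ℂ)) * polyC p = 1 := by
    rw [← coe_aeval_subtype hz p]
    exact congrArg Subtype.val hb
  have h2 : invPolyC p hp = b := by
    rw [← mul_one (invPolyC p hp), ← h1, mul_left_comm, invPolyC_mul, mul_one]
  rw [h2]
  exact b.2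

/-! ### Index sets bounded below, and their multipliers -/

/-- The multi-indices `α` with `n_j ≤ α_j` for all `j ∈ S`. -/
def upSet (n : Fin d → ℕ) (S : Set (Fin d)) : Set (Fin d → ℤ) :=
  {α | ∀ j ∈ S, (n j : ℤ) ≤ α j}

theorem upSet_inter {n : Fin d → ℕ} {S T : Set (Fin d)} (h : S ∪ T = Set.univ) :
    upSet n S ∩ upSet n T = upSet n Set.univ := by
  ext α
  refine ⟨fun hα j _ => ?_, fun hα => ⟨fun j _ => hα j trivial, fun j _ => hα j trivial⟩⟩
  rcases (h ▸ Set.mem_univ j : j ∈ S ∪ T) with hj | hj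
  exacts [hα.1 j hj, hα.2 j hj]

theorem upSet_anti (n : Fin d → ℕ) {S T : Set (Fin d)} (h : S ⊆ T) : upSet n T ⊆ upSet n S :=
  fun _ hα j hj => hα j (h hj)

/-- This form splits membership into an analyticity condition and an orthogonality condition. -/
theorem setX_eq (n : Fin d → ℕ) (S : Set (Fin d)) :
    setX n S = upSet 0 Set.univ ∩ (upSet n S)ᶜ := by
  ext α
  simp only [setX, setXj, upSet, Set.mem_iUnion, Set.mem_ofPred_eq, Set.mem_inter_iff,
    Set.mem_compl_iff, not_forall, not_le, Pi.zero_apply, Set.mem_univ, forall_const,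
    Nat.cast_zero, exists_prop, Pi.le_def]
  exact ⟨fun ⟨j, hj, h0, h1⟩ => ⟨h0, j, hj, h1⟩, fun ⟨h0, j, hj, h1⟩ => ⟨j, hj, h0, h1⟩⟩

theorem setB_eq (n : Fin d → ℕ) : setB n = setX n Set.univ := by
  ext α
  simp [setB, setX, setXj, Pi.le_def]

theorem mFourier_single_mem_multiplierAlg (n : Fin d → ℕ) (S : Set (Fin d)) (j : Fin d) :
    UnitAddTorus.mFourier (Pi.single j 1) ∈ multiplierAlg (spectralSub (upSet n S)) :=
  fun _ hf => mulL_mFourier_mem (fun α hα i hi => by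
    have h0 : 0 ≤ (Pi.single j (1 : ℤ) : Fin d → ℤ) i := by
      rw [Pi.single_apply]; split_ifs <;> simp
    have := hα i hi
    rw [Pi.add_apply]; omega) hf

theorem mulL_polyC_mem (p : MvPolynomial (Fin d) ℂ) {n : Fin d → ℕ} {S : Set (Fin d)}
    {f : L2sigma d} (hf : f ∈ spectralSub (upSet n S)) :
    mulL (polyC p) f ∈ spectralSub (upSet n S) := by
  have h : polyC p ∈ multiplierAlg (spectralSub (upSet n S)) := by
    rw [← coe_aeval_subtype (mFourier_single_mem_multiplierAlg n S) p]
    exact Subtype.property _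
  exact h f hf

/-- Zeros inside the polydisk, not only on the torus, must be excluded here: the multipliers form a
closed algebra containing the coordinates, but not their conjugates in general. -/
theorem mulL_invPolyC_mem {p : MvPolynomial (Fin d) ℂ} (hp : NoZeros p) {n : Fin d → ℕ}
    {S : Set (Fin d)} {f : L2sigma d} (hf : f ∈ spectralSub (upSet n S)) :
    mulL (invPolyC p hp) f ∈ spectralSub (upSet n S) :=
  invPolyC_mem (isClosed_multiplierAlg (isClosed_spectralSub _))
    (mFourier_single_mem_multiplierAlg n S) hp f hf

theorem mulL_invPolyC_polyC {p : MvPolynomial (Fin d) ℂ} (hp : NoZeros p) (f : L2sigma d) :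
    mulL (invPolyC p hp) (mulL (polyC p) f) = f := by
  rw [← mulL_mul, invPolyC_mul, mulL_one]

theorem mulL_polyC_invPolyC {p : MvPolynomial (Fin d) ℂ} (hp : NoZeros p) (f : L2sigma d) :
    mulL (polyC p) (mulL (invPolyC p hp) f) = f := by
  rw [← mulL_mul, mul_comm, invPolyC_mul, mulL_one]

theorem mFourier_natCast_apply (m : Fin d →₀ ℕ) (t : UnitAddTorus (Fin d)) :
    UnitAddTorus.mFourier (fun j => (m j : ℤ)) t = ∏ j, point t j ^ m j := by
  simp only [UnitAddTorus.mFourier, ContinuousMap.coe_mk, point]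
  refine Finset.prod_congr rfl fun j _ => ?_
  rw [fourier_apply, natCast_zsmul, AddCircle.toCircle_nsmul, Circle.coe_pow]

theorem polyC_eq_sum (p : MvPolynomial (Fin d) ℂ) :
    polyC p = ∑ m ∈ p.support, p.coeff m • UnitAddTorus.mFourier (fun j => (m j : ℤ)) := by
  ext t
  simp only [polyC, ContinuousMap.coe_mk, ContinuousMap.coe_sum, ContinuousMap.coe_smul,
    Finset.sum_apply, Pi.smul_apply, smul_eq_mul, mFourier_natCast_apply]
  exact MvPolynomial.eval_eq' _ _

/-- Each frequency of conj p lowers the j-th exponent by at most n_j. -/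
theorem mulL_star_polyC_mem {p : MvPolynomial (Fin d) ℂ} {n : Fin d → ℕ} (hdeg : DegLE p n)
    {S : Set (Fin d)} {f : L2sigma d} (hf : f ∈ spectralSub (upSet n S)) :
    mulL (star (polyC p)) f ∈ spectralSub (upSet 0 S) := by
  rw [polyC_eq_sum, star_sum, map_sum, _root_.sum_apply]
  refine Submodule.sum_mem _ fun m hm => ?_
  rw [star_smul, map_smul, star_mFourier]
  refine Submodule.smul_mem _ _ (mulL_mFourier_mem (fun α hα j hj => ?_) hf)
  have h1 : m j ≤ n j := (MvPolynomial.monomial_le_degreeOf j hm).trans (hdeg j)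
  have h2 := hα j hj
  simp only [Pi.zero_apply, Nat.cast_zero, Pi.add_apply, Pi.neg_apply]
  omega

/-! ### The phase and the orthogonality argument -/

/-- The unimodular function `conj p / p` on the torus. -/
def phase (p : MvPolynomial (Fin d) ℂ) (hp : NoZeros p) : C(UnitAddTorus (Fin d), ℂ) :=
  star (polyC p) * invPolyC p hp

theorem star_phase_mul_phase {p : MvPolynomial (Fin d) ℂ} (hp : NoZeros p) :
    star (phase p hp) * phase p hp = 1 := by
  have h := congrArg star (invPolyC_mul p hp)
  rw [star_mul, star_one] at h
  rw [phase, star_mul, star_star]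
  calc _ = (star (polyC p) * star (invPolyC p hp)) * (invPolyC p hp * polyC p) := by ring
    _ = 1 := by rw [h, invPolyC_mul, one_mul]

theorem inner_mulL_phase {p : MvPolynomial (Fin d) ℂ} (hp : NoZeros p) (f g : L2sigma d) :
    inner ℂ (mulL (phase p hp) f) (mulL (phase p hp) g) = inner ℂ f g := by
  rw [inner_mulL_left, ← mulL_mul, star_phase_mul_phase, mulL_one]

theorem mulL_phase_mem {p : MvPolynomial (Fin d) ℂ} (hp : NoZeros p) {n : Fin d → ℕ}
    (hdeg : DegLE p n) {S : Set (Fin d)} {f : L2sigma d} (hf : f ∈ spectralSub (upSet n S)) :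
    mulL (phase p hp) f ∈ spectralSub (upSet 0 S) := by
  rw [phase, mulL_mul]
  exact mulL_star_polyC_mem hdeg (mulL_invPolyC_mem hp hf)

/-- Multiplication by p is a bijection of H² and of H_S^n, so pF ⟂ H_S^n amounts to F ⟂ conj p ·
H_S^n = φ H_S^n. -/
theorem mulL_polyC_mem_setX_iff {p : MvPolynomial (Fin d) ℂ} (hp : NoZeros p) (n : Fin d → ℕ)
    (S : Set (Fin d)) (F : L2sigma d) :
    mulL (polyC p) F ∈ spectralSub (setX n S) ↔ F ∈ spectralSub (upSet 0 Set.univ) ∧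
      ∀ k ∈ spectralSub (upSet n S), inner ℂ (mulL (phase p hp) k) F = 0 := by
  rw [setX_eq, mem_spectralSub_inter, mem_spectralSub_compl]
  refine and_congr ⟨fun h => ?_, mulL_polyC_mem p⟩ ⟨fun h k hk => ?_, fun h k hk => ?_⟩
  · rw [← mulL_invPolyC_polyC hp F]
    exact mulL_invPolyC_mem hp h
  · rw [phase, mulL_mul, inner_mulL_left, star_star]
    exact h _ (mulL_invPolyC_mem hp hk)
  · have := h _ (mulL_polyC_mem p hk)
    rwa [phase, mulL_mul, mulL_invPolyC_polyC, inner_mulL_left, star_star] at this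

/-- In the transferred picture `f = p F`: a function with spectrum in `B` that is orthogonal to
those with spectrum in `X_S` has its spectrum in `X_T`. -/
theorem mulL_polyC_mem_of_orthogonal {p : MvPolynomial (Fin d) ℂ} (hp : NoZeros p)
    {n : Fin d → ℕ} (hdeg : DegLE p n) {S T : Set (Fin d)} (hunion : S ∪ T = Set.univ)
    {F : L2sigma d} (hF : mulL (polyC p) F ∈ spectralSub (setX n Set.univ))
    (horth : ∀ G, mulL (polyC p) G ∈ spectralSub (setX n S) → inner ℂ G F = 0) :
    mulL (polyC p) F ∈ spectralSub (setX n T) := by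
  rw [mulL_polyC_mem_setX_iff hp] at hF ⊢
  refine ⟨hF.1, fun h hh => ?_⟩
  obtain ⟨h₁, hS, hS', hY⟩ := exists_truncation (upSet n S) h
  have hn : h₁ ∈ spectralSub (upSet n Set.univ) := by
    rw [← upSet_inter hunion]
    exact mem_spectralSub_inter.2 ⟨hS, hY _ hh⟩
  obtain ⟨g₁, gS, gS', gY⟩ := exists_truncation (upSet 0 S) (mulL (phase p hp) h)
  have h0 : g₁ ∈ spectralSub (upSet 0 Set.univ) := by
    rw [← upSet_inter hunion]
    exact mem_spectralSub_inter.2 ⟨gS, gY _ (mulL_phase_mem hp hdeg hh)⟩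
  -- The test vector is orthogonal to φk for k ∈ H_S^n: since φk ∈ H_S^0 and φ is isometric, ⟨φk,
  -- g₁⟩ = ⟨φk, φh⟩ = ⟨k, h⟩ = ⟨k, h₁⟩ = ⟨φk, φh₁⟩.
  have he := horth (g₁ - mulL (phase p hp) h₁) <| by
    rw [mulL_polyC_mem_setX_iff hp]
    refine ⟨Submodule.sub_mem _ h0 (mulL_phase_mem hp hdeg hn), fun k hk => ?_⟩
    have e1 : inner ℂ (mulL (phase p hp) k) (mulL (phase p hp) h - g₁) = 0 :=
      inner_eq_zero_of_disjoint disjoint_compl_right (mulL_phase_mem hp hdeg hk) gS'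
    have e2 : inner ℂ k (h - h₁) = 0 := inner_eq_zero_of_disjoint disjoint_compl_right hk hS'
    rw [inner_sub_right] at e1 e2 ⊢
    rw [inner_mulL_phase] at e1 ⊢
    linear_combination e2 - e1
  -- φh = (g₁ - φh₁) + φh₁ + (φh - g₁), and F is orthogonal to each summand.
  have e3 := hF.2 h₁ hn
  have e4 : inner ℂ (mulL (phase p hp) h - g₁) F = 0 :=
    inner_eq_zero_of_disjoint disjoint_compl_left gS'
      (spectralSub_mono (upSet_anti 0 (Set.subset_univ S)) hF.1)
  rw [inner_sub_left] at he e4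
  linear_combination he + e3 + e4

/-! ### Transfer between `L²(μ)` and `L²(σ)` -/

theorem mu_le {p : MvPolynomial (Fin d) ℂ} (hp : NoZeros p) :
    ∃ c : ENNReal, c ≠ ⊤ ∧ mu p ≤ c • sigma d := by
  refine ⟨ENNReal.ofReal (‖invPolyC p hp‖ ^ 2), ENNReal.ofReal_ne_top, ?_⟩
  rw [mu, ← withDensity_const]
  refine withDensity_mono (Filter.Eventually.of_forall fun t => ?_)
  refine ENNReal.ofReal_le_ofReal ?_
  rw [one_div, ← inv_pow, ← norm_inv]
  exact pow_le_pow_left₀ (norm_nonneg _) ((invPolyC p hp).norm_coe_le_norm t) 2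

theorem memLp_sigma {p : MvPolynomial (Fin d) ℂ} (hp : NoZeros p) (f : L2 p) :
    MemLp f 2 (sigma d) := by
  obtain ⟨c, hc, hle⟩ := sigma_le hp
  exact (Lp.memLp f).of_measure_le_smul hc hle

/-- An element of `L²(μ)` regarded as an element of `L²(σ)`. -/
def toSigma {p : MvPolynomial (Fin d) ℂ} (hp : NoZeros p) (f : L2 p) : L2sigma d :=
  (memLp_sigma hp f).toLp

theorem toSigma_surjective {p : MvPolynomial (Fin d) ℂ} (hp : NoZeros p) :
    Function.Surjective (toSigma hp) := fun F => by
  obtain ⟨c, hc, hle⟩ := mu_le hp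
  have hF : MemLp F 2 (mu p) := (Lp.memLp F).of_measure_le_smul hc hle
  refine ⟨hF.toLp, Lp.ext ?_⟩
  exact (MemLp.coeFn_toLp _).trans ((sigma_ac hp).ae_eq hF.coeFn_toLp)

theorem inner_fourierBasis_toSigma {p : MvPolynomial (Fin d) ℂ} (hp : NoZeros p) (f : L2 p)
    (α : Fin d → ℤ) : inner ℂ (fourierBasis d α) (toSigma hp f) = coeff f α := by
  rw [L2.inner_def, coeff]
  refine integral_congr_ae ?_
  filter_upwards [coeFn_fourierBasis α, (memLp_sigma hp f).coeFn_toLp] with t h1 h2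
  rw [toSigma, h1, h2, RCLike.inner_apply, UnitAddTorus.mFourier_neg, mul_comm]

theorem mem_L2sub_iff {p : MvPolynomial (Fin d) ℂ} (hp : NoZeros p) {X : Set (Fin d → ℤ)}
    {f : L2 p} : f ∈ L2sub p hp X ↔ toSigma hp f ∈ spectralSub X := by
  simp only [mem_spectralSub, inner_fourierBasis_toSigma]
  rfl

/-- The density of μ is |1/p|², so division by p absorbs it. -/
theorem inner_mulL_invPolyC_toSigma {p : MvPolynomial (Fin d) ℂ} (hp : NoZeros p) (f g : L2 p) :
    inner ℂ (mulL (invPolyC p hp) (toSigma hp f)) (mulL (invPolyC p hp) (toSigma hp g)) =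
      inner ℂ f g := by
  have hm : Measurable fun t : UnitAddTorus (Fin d) =>
      ENNReal.ofReal (1 / ‖MvPolynomial.eval (point t) p‖ ^ 2) :=
    (((continuous_eval p).norm.pow 2).measurable.const_div 1).ennreal_ofReal
  rw [L2.inner_def, L2.inner_def]
  refine Eq.trans (integral_congr_ae ?_) (integral_withDensity_eq_integral_toReal_smul hm
    (Filter.Eventually.of_forall fun _ => ENNReal.ofReal_lt_top) _).symm
  filter_upwards [coeFn_mulL (invPolyC p hp) (toSigma hp f),
    coeFn_mulL (invPolyC p hp) (toSigma hp g), (memLp_sigma hp f).coeFn_toLp,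
    (memLp_sigma hp g).coeFn_toLp] with t h1 h2 h3 h4
  rw [h1, h2, toSigma, toSigma, h3, h4, ENNReal.toReal_ofReal (by positivity)]
  simp only [RCLike.inner_apply, map_mul, invPolyC, ContinuousMap.coe_mk, Complex.real_smul]
  push_cast
  rw [← Complex.mul_conj', map_inv₀, one_div, mul_inv]
  ring

/-- Fourier coefficients are given by inner products in `L²(μ)`. -/
theorem exists_inner_eq_coeff {p : MvPolynomial (Fin d) ℂ} (hp : NoZeros p) (α : Fin d → ℤ) :
    ∃ w : L2 p, ∀ f : L2 p, inner ℂ w f = coeff f α := by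
  -- The representative is |p|² z^α, whose factor |p|² cancels the density.
  obtain ⟨w, hw⟩ := toSigma_surjective hp
    (mulL (polyC p) (mulL (star (polyC p)) (fourierBasis d α)))
  refine ⟨w, fun f => ?_⟩
  rw [← inner_mulL_invPolyC_toSigma hp, hw, mulL_invPolyC_polyC, inner_mulL_left, star_star,
    mulL_polyC_invPolyC, inner_fourierBasis_toSigma]

theorem isClosed_L2sub {p : MvPolynomial (Fin d) ℂ} (hp : NoZeros p) (X : Set (Fin d → ℤ)) :
    IsClosed (L2sub p hp X : Set (L2 p)) := by
  choose w hw using exists_inner_eq_coeff hp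
  have : (L2sub p hp X : Set (L2 p)) = ⋂ α, ⋂ (_ : α ∉ X), {f | inner ℂ (w α) f = 0} := by
    ext f
    simp only [hw, Set.mem_iInter]
    rfl
  rw [this]
  exact isClosed_iInter fun α => isClosed_iInter fun _ =>
    isClosed_eq (continuous_const.inner continuous_id) continuous_const

theorem L2sub_mono {p : MvPolynomial (Fin d) ℂ} (hp : NoZeros p) {X Y : Set (Fin d → ℤ)}
    (h : X ⊆ Y) : L2sub p hp X ≤ L2sub p hp Y :=
  fun _ hf α hα => hf α fun hX => hα (h hX)

theorem mem_L2sub_inter {p : MvPolynomial (Fin d) ℂ} (hp : NoZeros p) {X Y : Set (Fin d → ℤ)}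
    {f : L2 p} (hX : f ∈ L2sub p hp X) (hY : f ∈ L2sub p hp Y) : f ∈ L2sub p hp (X ∩ Y) :=
  fun α hα => (not_and_or.1 hα).elim (hX α) (hY α)

theorem setX_subset_setB (n : Fin d → ℕ) (S : Set (Fin d)) : setX n S ⊆ setB n := by
  rw [setB_eq]
  exact Set.biUnion_mono (Set.subset_univ S) fun _ _ => subset_rfl

theorem mem_L2sub_setX_of_orthogonal {p : MvPolynomial (Fin d) ℂ} (hp : NoZeros p)
    {n : Fin d → ℕ} (hdeg : DegLE p n) {S T : Set (Fin d)} (hunion : S ∪ T = Set.univ) {f : L2 p}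
    (hf : f ∈ L2sub p hp (setB n)) (horth : f ∈ (L2sub p hp (setX n S))ᗮ) :
    f ∈ L2sub p hp (setX n T) := by
  rw [mem_L2sub_iff, ← mulL_polyC_invPolyC hp (toSigma hp f)]
  refine mulL_polyC_mem_of_orthogonal hp hdeg hunion ?_ fun G hG => ?_
  · rwa [mulL_polyC_invPolyC, ← mem_L2sub_iff, ← setB_eq]
  · obtain ⟨g, hg⟩ := toSigma_surjective hp (mulL (polyC p) G)
    rw [← mulL_invPolyC_polyC hp G, ← hg, inner_mulL_invPolyC_toSigma]
    refine (Submodule.mem_orthogonal _ _).1 horth g ?_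
    rwa [mem_L2sub_iff, hg]

end BernsteinSzego

end

/-! ### The orthogonal decomposition -/

theorem mainTheorem3 {d : ℕ} (n : Fin d → ℕ) (p : MvPolynomial (Fin d) ℂ)
    (hp : BernsteinSzego.NoZeros p) (hdeg : BernsteinSzego.DegLE p n)
    (S T : Set (Fin d)) (hdisj : Disjoint S T) (hunion : S ∪ T = Set.univ) :
    BernsteinSzego.L2sub p hp (BernsteinSzego.setX n S) ⟂
        BernsteinSzego.L2minus p hp (BernsteinSzego.setX n T)
          (BernsteinSzego.setX n T ∩ BernsteinSzego.setX n S) ∧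
      BernsteinSzego.L2sub p hp (BernsteinSzego.setX n S) ⊔
        BernsteinSzego.L2minus p hp (BernsteinSzego.setX n T)
          (BernsteinSzego.setX n T ∩ BernsteinSzego.setX n S) =
      BernsteinSzego.L2sub p hp (BernsteinSzego.setB n) := by
  have hcomplete : CompleteSpace (BernsteinSzego.L2sub p hp (BernsteinSzego.setX n S)) :=
    (BernsteinSzego.isClosed_L2sub hp _).completeSpace_coe
  have hsplit : ∀ f ∈ BernsteinSzego.L2sub p hp (BernsteinSzego.setB n),
      ∃ a ∈ BernsteinSzego.L2sub p hp (BernsteinSzego.setX n S),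
        f - a ∈ BernsteinSzego.L2sub p hp (BernsteinSzego.setX n T) ∧
        f - a ∈ (BernsteinSzego.L2sub p hp (BernsteinSzego.setX n S))ᗮ := by
    intro f hf
    have ha := Submodule.starProjection_apply_mem
      (BernsteinSzego.L2sub p hp (BernsteinSzego.setX n S)) f
    have hb := Submodule.sub_starProjection_mem_orthogonal
      (K := BernsteinSzego.L2sub p hp (BernsteinSzego.setX n S)) f
    refine ⟨_, ha, BernsteinSzego.mem_L2sub_setX_of_orthogonal hp hdeg hunion ?_ hb, hb⟩
    exact Submodule.sub_mem _ hf
      (BernsteinSzego.L2sub_mono hp (BernsteinSzego.setX_subset_setB n S) ha)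
  refine ⟨Submodule.isOrtho_iff_le.2 fun g hg => ?_, le_antisymm (sup_le ?_ ?_) fun f hf => ?_⟩
  · rw [BernsteinSzego.L2minus, Submodule.mem_orthogonal']
    intro f hf
    obtain ⟨a, ha, hT, horth⟩ := hsplit f
      (BernsteinSzego.L2sub_mono hp (BernsteinSzego.setX_subset_setB n T) hf.1)
    -- The projection a of f onto L²_μ(X_S) also lies in L²_μ(X_T), hence in the space of X_T ∩ X_S,
    -- to which f is orthogonal. As a is also orthogonal to f - a, it vanishes.
    have haT : a ∈ BernsteinSzego.L2sub p hp (BernsteinSzego.setX n T) := by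
      have := Submodule.sub_mem _ hf.1 hT
      rwa [sub_sub_cancel] at this
    have h1 : inner ℂ a f = 0 := (Submodule.mem_orthogonal _ _).1 hf.2 a
      (BernsteinSzego.mem_L2sub_inter hp haT ha)
    have h2 : inner ℂ a (f - a) = 0 := (Submodule.mem_orthogonal _ _).1 horth a ha
    have h3 : a = 0 := by
      rwa [inner_sub_right, h1, zero_sub, neg_eq_zero, inner_self_eq_zero] at h2
    rw [h3, sub_zero] at horth
    exact (Submodule.mem_orthogonal _ _).1 horth g hg
  · exact BernsteinSzego.L2sub_mono hp (BernsteinSzego.setX_subset_setB n S)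
  · exact inf_le_left.trans (BernsteinSzego.L2sub_mono hp (BernsteinSzego.setX_subset_setB n T))
  · obtain ⟨a, ha, hT, horth⟩ := hsplit f hf
    rw [← add_sub_cancel a f]
    refine Submodule.add_mem_sup ha ⟨hT, ?_⟩
    exact Submodule.orthogonal_le (BernsteinSzego.L2sub_mono hp Set.inter_subset_right) horth
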